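/- **Setting.** Let $p\in\{2,3\}$, let $\Omega\subset\mathbb R^p$ be open (for instance a bounded simply connected Lipschitz domain) with boundary $\Gamma$ and outward unit normal $\mathbf n$, let $\varepsilon_0,\mu_0,\omega>0$ and $k=\omega\sqrt{\mu_0\varepsilon_0}$. Here $\operatorname{curl}$ is scalar-valued if $p=2$. Let $H(\operatorname{curl})=\{u\in L^2(\Omega)^p:\operatorname{curl}u\in L^2(\Omega)\}$ consist of complex fields, with norm $\|u\|^2=\|u\|_{L^2}^2+\|\operatorname{curl}u\|_{L^2}^2$, and let $(u,v)=\int_\Omega u\cdot\overline v$. Let $Y(\Gamma)$ be the space of tangential traces $\gamma_t u=u\times\mathbf n$, $u\in H(\operatorname{curl})$ (defined weakly by Green's formula), with the quotient norm $\inf\{\|u\|:\gamma_tu=f\}$; the trace $u\times\mathbf n$ and the tangential component $u_T=\mathbf n\times(u\times\mathbf n)$ are identified. Fix a Neumann datum $\mathbf g_N\in Y(\Gamma)'$, the duality bracket $\langle \mathbf g_N,\varphi_T\rangle_\Gamma$ being antilinear in $\varphi$. A function $\kappa:\Omega\to\mathbb C$ is an *admissible refractive index* if $\kappa=\frac1{\varepsilon_0}\bigl(\varepsilon+i\frac{\sigma}{\omega}\bigr)$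 a.e. in $\Omega$ with real $\varepsilon,\sigma\in L^\infty(\Omega)$ such that $\varepsilon\ge\tilde\varepsilon$ and $\sigma\ge\tilde\sigma$ a.e. in $\Omega$ for some constants $\tilde\varepsilon,\tilde\sigma>0$. For such $\kappa$, let $\mathbf E[\kappa]\in H(\operatorname{curl})$ be the weak solution of $\operatorname{curl}\operatorname{curl}\mathbf E-k^2\kappa\mathbf E=0$ in $\Omega$, $\operatorname{curl}\mathbf E\times\mathbf n=\mathbf g_N$ on $\Gamma$, that is, the solution of $$(\operatorname{curl}\mathbf E,\operatorname{curl}\varphi)-k^2(\kappa\mathbf E,\varphi)=\langle\mathbf g_N,\varphi_T\rangle_\Gamma\qquad\text{for all }\varphi\in H(\operatorname{curl}).$$ **Theorem.** Let $D$ be a measurable set with characteristic function $\chi_D$, let $\kappa_0$ be a complex function, put $\kappa_a=\kappa_0(1+a\chi_D)$ for $a\in\mathbb R$, and let $I\subset\mathbb R$ be an open interval such that $\kappa_a$ is an admissible refractive index for every $a\in I$. Then for every $a\in I$ the direct problem with index $\kappa_a$ has exactly one solution $\mathbf E[\kappa_a]$, and the map $K:a\mapsto\mathbf E[\kappa_a]$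 belongs to $C^\infty(I;H(\operatorname{curl}))$. Moreover, writing $\mathbf E_a^{(n)}=K^{(n)}(a)$, one has $\mathbf E_a^{(0)}=\mathbf E[\kappa_a]$ and, for every $a\in I$ and every integer $n\ge1$, $\mathbf E_a^{(n)}$ is the unique solution in $H(\operatorname{curl})$ of $$(\operatorname{curl}\mathbf E_a^{(n)},\operatorname{curl}\varphi)-k^2(\kappa_a\mathbf E_a^{(n)},\varphi)=n\,k^2\,(\kappa_0\chi_D\mathbf E_a^{(n-1)},\varphi)\qquad\text{for all }\varphi\in H(\operatorname{curl}).$$ -/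

import Mathlib

open MeasureTheory

namespace Maxwell

noncomputable section

/-- The space dimension `p ∈ {2, 3}`. -/
inductive Dim
  | two
  | three

/-- The dimension `p` of the physical space, as a number. -/
abbrev Dim.p : Dim → ℕ
  | .two => 2
  | .three => 3

/-- The number of components of the curl of a vector field:
the curl is scalar in the plane and a vector in space. -/
abbrev Dim.q : Dim → ℕ
  | .two => 1
  | .three => 3

/-- The physical space `ℝᵖ`. -/
abbrev Space (d : Dim) : Type := EuclideanSpace ℝ (Fin d.p)

/-- The space `ℂᵖ` of values of vector fields. -/
abbrev Vec (d : Dim) : Type := EuclideanSpace ℂ (Fin d.p)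

/-- The space of values of curls of vector fields: `ℂ` for `p = 2` and `ℂ³` for `p = 3`. -/
abbrev CVec (d : Dim) : Type := EuclideanSpace ℂ (Fin d.q)

/-- The cross product `ξ × u` of a real vector and a complex vector:
`ξ₁ u₂ - ξ₂ u₁` in the plane, the usual vector product in space. -/
def cross : (d : Dim) → Space d → Vec d → CVec d
  | .two, (ξ : EuclideanSpace ℝ (Fin 2)), (u : EuclideanSpace ℂ (Fin 2)) =>
      !₂[(ξ 0 : ℂ) * u 1 - (ξ 1 : ℂ) * u 0]
  | .three, (ξ : EuclideanSpace ℝ (Fin 3)), (u : EuclideanSpace ℂ (Fin 3)) =>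
      !₂[(ξ 1 : ℂ) * u 2 - (ξ 2 : ℂ) * u 1,
         (ξ 2 : ℂ) * u 0 - (ξ 0 : ℂ) * u 2,
         (ξ 0 : ℂ) * u 1 - (ξ 1 : ℂ) * u 0]

theorem cross_add (d : Dim) (ξ : Space d) (u v : Vec d) :
    cross d ξ (u + v) = cross d ξ u + cross d ξ v := by
  cases d <;> ext l <;> fin_cases l <;> simp [cross] <;> ring

theorem cross_smul (d : Dim) (ξ : Space d) (c : ℂ) (u : Vec d) :
    cross d ξ (c • u) = c • cross d ξ u := by
  cases d <;> ext l <;> fin_cases l <;> simp [cross] <;> ring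

theorem continuous_cross (d : Dim) :
    Continuous fun z : Space d × Vec d => cross d z.1 z.2 := by
  cases d <;> simp only [cross] <;> fun_prop

theorem norm_cross_le (d : Dim) (ξ : Space d) (u : Vec d) :
    ‖cross d ξ u‖ ≤ 6 * (‖ξ‖ * ‖u‖) := by
  have h1 : ∀ i, ‖(ξ i : ℂ)‖ ≤ ‖ξ‖ := fun i => by
    simpa using PiLp.norm_apply_le ξ i
  have h2 : ∀ i, ‖u i‖ ≤ ‖u‖ := fun i => PiLp.norm_apply_le u i
  have h3 : ∀ i j k l, ‖(ξ i : ℂ) * u j - (ξ k : ℂ) * u l‖ ≤ 2 * (‖ξ‖ * ‖u‖) := fun i j k l => by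
    refine (norm_sub_le _ _).trans ?_
    rw [norm_mul, norm_mul, two_mul]
    gcongr
    · exact h1 i
    · exact h2 j
    · exact h1 k
    · exact h2 l
  have h0 : 0 ≤ ‖ξ‖ * ‖u‖ := by positivity
  have h4 : ∀ l, ‖cross d ξ u l‖ ≤ 2 * (‖ξ‖ * ‖u‖) := by
    cases d <;> intro l <;> fin_cases l <;> exact h3 _ _ _ _
  have h5 : d.q ≤ 3 := by cases d <;> simp
  rw [EuclideanSpace.norm_eq]
  apply Real.sqrt_le_iff.2 ⟨by positivity, ?_⟩
  calc ∑ l, ‖cross d ξ u l‖ ^ 2 ≤ ∑ _l : Fin d.q, (2 * (‖ξ‖ * ‖u‖)) ^ 2 := by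
        gcongr with l; exact h4 l
    _ = d.q * (2 * (‖ξ‖ * ‖u‖)) ^ 2 := by simp
    _ ≤ 3 * (2 * (‖ξ‖ * ‖u‖)) ^ 2 := by gcongr; exact_mod_cast h5
    _ ≤ _ := by nlinarith [sq_nonneg (‖ξ‖ * ‖u‖)]

/-- `L²(Ω)ᵖ`, the square integrable complex vector fields on `Ω`. -/
abbrev L2Vec (d : Dim) (Ω : Set (Space d)) : Type := Lp (Vec d) 2 (volume.restrict Ω)

/-- The square integrable fields on `Ω` of the kind of a curl. -/
abbrev L2CVec (d : Dim) (Ω : Set (Space d)) : Type := Lp (CVec d) 2 (volume.restrict Ω)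

/-- Real test functions `ψ ∈ C_c^∞(ℝᵖ)`. -/
structure IsTest {d : Dim} (ψ : Space d → ℝ) : Prop where
  contDiff : ContDiff ℝ (⊤ : ℕ∞) ψ
  hasCompactSupport : HasCompactSupport ψ

theorem IsTest.integrable_smul {d : Dim} {Ω : Set (Space d)} {ψ : Space d → ℝ} (hψ : IsTest ψ)
    (w : L2CVec d Ω) : Integrable (fun x => ψ x • w x) (volume.restrict Ω) :=
  memLp_one_iff_integrable.1 <| MemLp.smul (p := 2) (q := 2) (r := 1) (Lp.memLp w)
    ((hψ.contDiff.continuous.memLp_of_hasCompactSupport hψ.hasCompactSupport).restrict Ω)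

theorem IsTest.integrable_cross {d : Dim} {Ω : Set (Space d)} {ψ : Space d → ℝ} (hψ : IsTest ψ)
    (u : L2Vec d Ω) :
    Integrable (fun x => cross d (gradient ψ x) (u x)) (volume.restrict Ω) := by
  have hc : Continuous (gradient ψ) :=
    (InnerProductSpace.toDual ℝ (Space d)).symm.continuous.comp
      (hψ.contDiff.continuous_fderiv (by simp))
  have hs : HasCompactSupport (gradient ψ) :=
    (hψ.hasCompactSupport.fderiv ℝ).comp_left
      (g := (InnerProductSpace.toDual ℝ (Space d)).symm) (map_zero _)
  have hm : MemLp (gradient ψ) 2 (volume.restrict Ω) :=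
    (hc.memLp_of_hasCompactSupport hs).restrict Ω
  have hi : Integrable (fun x => ‖gradient ψ x‖ * ‖u x‖) (volume.restrict Ω) :=
    hm.norm.integrable_mul (Lp.memLp u).norm
  refine (hi.const_mul 6).mono' ?_ (Filter.Eventually.of_forall fun x => norm_cross_le d _ _)
  exact (continuous_cross d).comp_aestronglyMeasurable
    (hm.aestronglyMeasurable.prodMk (Lp.memLp u).aestronglyMeasurable)

/-- The defect `∫_Ω (ψ w + ∇ψ × u)` in the integration by parts formula for `w = curl u`. -/
def greenDefect (d : Dim) (Ω : Set (Space d)) (ψ : Space d → ℝ)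
    (u : L2Vec d Ω) (w : L2CVec d Ω) : CVec d :=
  (∫ x in Ω, ψ x • w x) + ∫ x in Ω, cross d (gradient ψ x) (u x)

theorem greenDefect_add {d : Dim} {Ω : Set (Space d)} {ψ : Space d → ℝ} (hψ : IsTest ψ)
    (u u' : L2Vec d Ω) (w w' : L2CVec d Ω) :
    greenDefect d Ω ψ (u + u') (w + w') = greenDefect d Ω ψ u w + greenDefect d Ω ψ u' w' := by
  have h1 : ∫ x in Ω, ψ x • (w + w' : L2CVec d Ω) x
      = (∫ x in Ω, ψ x • w x) + ∫ x in Ω, ψ x • w' x := by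
    rw [← integral_add (hψ.integrable_smul w) (hψ.integrable_smul w')]
    refine integral_congr_ae ?_
    filter_upwards [Lp.coeFn_add w w'] with x hx
    rw [hx, Pi.add_apply, smul_add]
  have h2 : ∫ x in Ω, cross d (gradient ψ x) ((u + u' : L2Vec d Ω) x)
      = (∫ x in Ω, cross d (gradient ψ x) (u x)) + ∫ x in Ω, cross d (gradient ψ x) (u' x) := by
    rw [← integral_add (hψ.integrable_cross u) (hψ.integrable_cross u')]
    refine integral_congr_ae ?_
    filter_upwards [Lp.coeFn_add u u'] with x hx
    rw [hx, Pi.add_apply, cross_add]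
  rw [greenDefect, h1, h2, greenDefect, greenDefect]
  abel

theorem greenDefect_smul {d : Dim} {Ω : Set (Space d)} (ψ : Space d → ℝ)
    (c : ℂ) (u : L2Vec d Ω) (w : L2CVec d Ω) :
    greenDefect d Ω ψ (c • u) (c • w) = c • greenDefect d Ω ψ u w := by
  have h1 : ∫ x in Ω, ψ x • (c • w : L2CVec d Ω) x = c • ∫ x in Ω, ψ x • w x := by
    rw [← integral_smul]
    refine integral_congr_ae ?_
    filter_upwards [Lp.coeFn_smul c w] with x hx
    rw [hx, Pi.smul_apply, smul_comm]
  have h2 : ∫ x in Ω, cross d (gradient ψ x) ((c • u : L2Vec d Ω) x)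
      = c • ∫ x in Ω, cross d (gradient ψ x) (u x) := by
    rw [← integral_smul]
    refine integral_congr_ae ?_
    filter_upwards [Lp.coeFn_smul c u] with x hx
    rw [hx, Pi.smul_apply, cross_smul]
  rw [greenDefect, h1, h2, greenDefect, smul_add]

/-- `w = curl u` in the sense of distributions on `Ω`:
`∫_Ω ψ w = - ∫_Ω ∇ψ × u` for every test function `ψ ∈ C_c^∞(Ω)`. -/
def IsWeakCurl {d : Dim} {Ω : Set (Space d)} (u : L2Vec d Ω) (w : L2CVec d Ω) : Prop :=
  ∀ ψ : Space d → ℝ, IsTest ψ → tsupport ψ ⊆ Ω →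
    ∫ x in Ω, ψ x • w x = -∫ x in Ω, cross d (gradient ψ x) (u x)

theorem isWeakCurl_iff {d : Dim} {Ω : Set (Space d)} {u : L2Vec d Ω} {w : L2CVec d Ω} :
    IsWeakCurl u w ↔ ∀ ψ : Space d → ℝ, IsTest ψ → tsupport ψ ⊆ Ω →
      greenDefect d Ω ψ u w = 0 := by
  simp only [IsWeakCurl, greenDefect, add_eq_zero_iff_eq_neg]

/-- The space `H(curl)` of all `u ∈ L²(Ω)ᵖ` with `curl u ∈ L²(Ω)`. A field is stored with its
(unique) weak curl as the pair `(u, curl u)`, and the norm is the graph norm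
`‖u‖² = ‖u‖²_{L²} + ‖curl u‖²_{L²}`. -/
def HCurlSubmodule (d : Dim) (Ω : Set (Space d)) :
    Submodule ℂ (WithLp 2 (L2Vec d Ω × L2CVec d Ω)) where
  carrier := {z | IsWeakCurl z.fst z.snd}
  zero_mem' := isWeakCurl_iff.2 fun ψ _ _ => by
    simpa using greenDefect_smul (Ω := Ω) ψ 0 0 0
  add_mem' := fun {y z} hy hz => isWeakCurl_iff.2 fun ψ hψ hs => by
    have := greenDefect_add hψ y.fst z.fst y.snd z.snd
    rw [isWeakCurl_iff.1 hy ψ hψ hs, isWeakCurl_iff.1 hz ψ hψ hs, add_zero] at this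
    exact this
  smul_mem' := fun c z hz => isWeakCurl_iff.2 fun ψ hψ hs => by
    have := greenDefect_smul ψ c z.fst z.snd
    rw [isWeakCurl_iff.1 hz ψ hψ hs, smul_zero] at this
    exact this

/-- The Hilbert space `H(curl)`. -/
abbrev HCurl (d : Dim) (Ω : Set (Space d)) : Type := HCurlSubmodule d Ω

/-- The underlying `L²` field of an element of `H(curl)`. -/
def field {d : Dim} {Ω : Set (Space d)} (E : HCurl d Ω) : L2Vec d Ω := E.1.fst

/-- The curl of an element of `H(curl)`. -/
def curl {d : Dim} {Ω : Set (Space d)} (E : HCurl d Ω) : L2CVec d Ω := E.1.snd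

/-- The tangential trace `γ_t u = u × n` on the boundary `Γ` of `Ω`, as the distribution
`ψ ↦ ∫_Γ ψ (u × n) = - ∫_Ω (ψ curl u + ∇ψ × u)` carried by `Γ`. The right-hand side is continuous
in `u ∈ H(curl)` and is, by the divergence theorem, the boundary integral if `u` is smooth up to
a Lipschitz boundary: it is the continuous extension of `u ↦ u|_Γ × n`. -/
def tangentialTrace (d : Dim) (Ω : Set (Space d)) :
    HCurl d Ω →ₗ[ℂ] ({ψ : Space d → ℝ // IsTest ψ} → CVec d) where
  toFun u := fun ψ => -greenDefect d Ω ψ.1 (field u) (curl u)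
  map_add' u v := by
    funext ψ
    have := greenDefect_add ψ.2 (field u) (field v) (curl u) (curl v)
    exact (congrArg Neg.neg this).trans (neg_add _ _)
  map_smul' c u := by
    funext ψ
    have := greenDefect_smul ψ.1 c (field u) (curl u)
    exact (congrArg Neg.neg this).trans (smul_neg _ _).symm

/-- The trace space `Y(Γ)`, the range of the tangential trace on `H(curl)`, with its norm
`‖f‖ = inf {‖u‖_{H(curl)} : u has trace f}`: it is the quotient of `H(curl)` by the kernel of the
trace. Since `u × n` and `u_T = n × (u × n)` determine each other, both are represented by the
class of `u`. -/
abbrev TraceSpace (d : Dim) (Ω : Set (Space d)) : Type :=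
  HCurl d Ω ⧸ LinearMap.ker (tangentialTrace d Ω)

/-- The tangential component `φ_T` on `Γ` of `φ ∈ H(curl)`. -/
def tangentialComponent {d : Dim} {Ω : Set (Space d)} (φ : HCurl d Ω) : TraceSpace d Ω :=
  Submodule.Quotient.mk φ

/-- The dual `Y(Γ)'` of the trace space, the space of Neumann data `g = curl E × n`. In agreement
with the inner product of `L²`, the duality bracket `⟨g, φ_T⟩` is antilinear in `φ`. -/
abbrev NeumannData (d : Dim) (Ω : Set (Space d)) : Type := TraceSpace d Ω →L⋆[ℂ] ℂ

/-- The pair of coefficients `(ε, σ)` is admissible in `Ω`: both are bounded and measurable, and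
bounded from below almost everywhere by positive constants. -/
structure IsAdmissiblePair {d : Dim} (Ω : Set (Space d)) (ε σ : Space d → ℝ) : Prop where
  bounded_permittivity : MemLp ε ⊤ (volume.restrict Ω)
  bounded_conductivity : MemLp σ ⊤ (volume.restrict Ω)
  permittivity_pos : ∃ c : ℝ, 0 < c ∧ ∀ᵐ x ∂(volume.restrict Ω), c ≤ ε x
  conductivity_pos : ∃ c : ℝ, 0 < c ∧ ∀ᵐ x ∂(volume.restrict Ω), c ≤ σ x

/-- The complex refractive index `κ = (ε + i σ / ω) / ε₀`. -/
def refractiveIndex {d : Dim} (ε₀ ω : ℝ) (ε σ : Space d → ℝ) (x : Space d) : ℂ :=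
  1 / (ε₀ : ℂ) * ((ε x : ℂ) + Complex.I * ((σ x : ℂ) / (ω : ℂ)))

/-- `κ` is an admissible refractive index: it is the index of an admissible pair. -/
def IsAdmissible {d : Dim} (Ω : Set (Space d)) (ε₀ ω : ℝ) (κ : Space d → ℂ) : Prop :=
  ∃ ε σ : Space d → ℝ, IsAdmissiblePair Ω ε σ ∧
    ∀ᵐ x ∂(volume.restrict Ω), κ x = refractiveIndex ε₀ ω ε σ x

/-- The wave number `k = ω √(μ₀ ε₀)`. -/
def waveNumber (ε₀ μ₀ ω : ℝ) : ℝ := ω * Real.sqrt (μ₀ * ε₀)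

/-- The dot product `(u, v) = ∫_Ω u · v̄` of `L²(Ω)`. -/
def dotL2 {d : Dim} {m : ℕ} (Ω : Set (Space d)) (u v : Space d → EuclideanSpace ℂ (Fin m)) : ℂ :=
  ∫ x in Ω, inner ℂ (v x) (u x)

/-- The sesquilinear form `(curl E, curl φ) - k² (κ E, φ)`. -/
def maxwellForm {d : Dim} {Ω : Set (Space d)} (k : ℝ) (κ : Space d → ℂ) (E φ : HCurl d Ω) : ℂ :=
  dotL2 Ω (curl E) (curl φ) - (k : ℂ) ^ 2 * dotL2 Ω (fun x => κ x • field E x) (field φ)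

/-- `E ∈ H(curl)` is the (weak) solution of the direct problem `curl curl E - k² κ E = 0` in `Ω`,
`curl E × n = g` on `Γ`. -/
def IsDirectSolution {d : Dim} {Ω : Set (Space d)} (k : ℝ) (g : NeumannData d Ω)
    (κ : Space d → ℂ) (E : HCurl d Ω) : Prop :=
  ∀ φ : HCurl d Ω, maxwellForm k κ E φ = g (tangentialComponent φ)

/-- The field `E[κ]`, the solution of the direct problem. -/
def directSolution {d : Dim} {Ω : Set (Space d)} (k : ℝ) (g : NeumannData d Ω)
    (κ : Space d → ℂ) : HCurl d Ω :=
  Classical.epsilon fun E => IsDirectSolution k g κ E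

/-- The characteristic function `χ_D`. -/
def chi {d : Dim} (D : Set (Space d)) : Space d → ℂ := D.indicator fun _ => 1

/-- The perturbed refractive index `κ_a = κ₀ (1 + a χ_D)`. -/
def perturbedIndex {d : Dim} (κ₀ : Space d → ℂ) (D : Set (Space d)) (a : ℝ) (x : Space d) : ℂ :=
  κ₀ x * (1 + (a : ℂ) * chi D x)

/-- The map `K : a ↦ E[κ_a]`. -/
def amplitudeToField {d : Dim} {Ω : Set (Space d)} (k : ℝ) (g : NeumannData d Ω)
    (κ₀ : Space d → ℂ) (D : Set (Space d)) (a : ℝ) : HCurl d Ω :=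
  directSolution k g (perturbedIndex κ₀ D a)

/-- `E` solves the sensitivity equation of rank `n` at `a`, with `F` in the place of the derivative
of order `n - 1`:
`(curl E, curl φ) - k² (κ_a E, φ) = n k² (κ₀ χ_D F, φ)` for all `φ ∈ H(curl)`. -/
def IsSensitivitySolution {d : Dim} {Ω : Set (Space d)} (k : ℝ) (κ₀ : Space d → ℂ)
    (D : Set (Space d)) (a : ℝ) (n : ℕ) (F E : HCurl d Ω) : Prop :=
  ∀ φ : HCurl d Ω, maxwellForm k (perturbedIndex κ₀ D a) E φ
    = (n : ℂ) * (k : ℂ) ^ 2 * dotL2 Ω (fun x => (κ₀ x * chi D x) • field F x) (field φ)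

end

end Maxwell

/-! Since $\kappa_a=\kappa_0+a\,\kappa_0\chi_D$, Riesz representation turns the direct problem into
an affine family of equations $(A+aB)K(a)=G$ in the Hilbert space $H(\operatorname{curl})$. Here $A$
is the operator of the form with index $\kappa_0$, and $B$ is $-k^2$ times the mass operator of
$\kappa_0\chi_D$.

Invertibility for $a\in I$ comes from absorption: $\operatorname{Im}\kappa_a$ is bounded below by a
positive constant. Multiplying the form by $1+it$ with $t$ large makes the real part of
$-(1+it)k^2\kappa_a$ at least $1$ and keeps $\|\operatorname{curl}E\|^2$ as real part of the curl
term. The rotated form is thus coercive (`isUnit_maxwellOp`), and no compactness is needed. $A$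
itself need not be invertible, since $0$ may lie outside $I$.

Inversion is smooth on the units of a Banach algebra, so $K(a)=(A+aB)^{-1}G$ is smooth
(`contDiffOn_of_affine_family`). Differentiating the equation repeatedly gives
$(A+aB)K^{(n)}=-nBK^{(n-1)}$ (`iteratedDeriv_of_affine_family`), which is the sensitivity equation.
Uniqueness is injectivity of $A+aB$. -/

namespace Maxwell

/-! ### Affine families of operator equations in a Hilbert space -/

section Hilbert

variable {H : Type*} [NormedAddCommGroup H] [InnerProductSpace ℂ H]

/-- The Lax-Milgram theorem for a bounded operator that is coercive after a rotation. -/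
theorem isUnit_of_rotated_coercive [CompleteSpace H] (A : H →L[ℂ] H) (c : ℂ)
    (h : ∀ x, ‖x‖ ^ 2 ≤ (c * inner ℂ x (A x)).re) : IsUnit A := by
  have hb : ∀ x, ‖x‖ ≤ ‖c‖ * ‖A x‖ := fun x => by
    rcases (norm_nonneg x).eq_or_lt with h0 | h0
    · rw [← h0]; positivity
    · have h1 : ‖x‖ ^ 2 ≤ ‖c‖ * (‖x‖ * ‖A x‖) :=
        (h x).trans <| (Complex.re_le_norm _).trans <| by
          rw [norm_mul]; gcongr; exact norm_inner_le_norm _ _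
      nlinarith
  have ha : AntilipschitzWith ‖c‖₊ A := A.antilipschitz_of_bound hb
  -- The range is dense: coercivity forces any `x` orthogonal to it, in particular to `A x`, to
  -- vanish. The lower bound `hb` makes it closed as well.
  have hr : (LinearMap.range (A : H →ₗ[ℂ] H))ᗮ = ⊥ := by
    refine (Submodule.eq_bot_iff _).2 fun x hx => ?_
    have h1 : inner ℂ x (A x) = 0 :=
      Submodule.inner_left_of_mem_orthogonal (LinearMap.mem_range_self (A : H →ₗ[ℂ] H) x) hx
    have h2 := h x
    rw [h1, mul_zero, Complex.zero_re] at h2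
    exact norm_eq_zero.1 (pow_eq_zero_iff two_ne_zero |>.1 (le_antisymm h2 (sq_nonneg _)))
  refine ContinuousLinearMap.isUnit_iff_bijective.2 ⟨ha.injective, ?_⟩
  have hc : IsClosed (LinearMap.range (A : H →ₗ[ℂ] H) : Set H) := by
    exact ha.isClosed_range A.uniformContinuous
  have : CompleteSpace (LinearMap.range (A : H →ₗ[ℂ] H)) := hc.completeSpace_coe
  exact LinearMap.range_eq_top.1 ((Submodule.orthogonal_eq_bot_iff).1 hr)

/-- Solutions of an affine family of invertible equations depend smoothly on the parameter. -/
theorem contDiffOn_of_affine_family [CompleteSpace H] (A B : H →L[ℂ] H) (G : H) {I : Set ℝ}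
    (hu : ∀ a ∈ I, IsUnit (A + (a : ℂ) • B)) {K : ℝ → H}
    (hK : ∀ a ∈ I, (A + (a : ℂ) • B) (K a) = G) : ContDiffOn ℝ (⊤ : ℕ∞) K I := by
  have hp : ContDiff ℝ (⊤ : ℕ∞) fun a : ℝ => A + (a : ℂ) • B :=
    contDiff_const.add (Complex.ofRealCLM.contDiff.smul contDiff_const)
  have hs : ContDiffOn ℝ (⊤ : ℕ∞) (fun a : ℝ => Ring.inverse (A + (a : ℂ) • B) G) I := by
    intro a ha
    obtain ⟨v, hv⟩ := hu a ha
    have h1 : ContDiffAt ℝ (⊤ : ℕ∞) (Ring.inverse : (H →L[ℂ] H) → H →L[ℂ] H)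
        (A + (a : ℂ) • B) := hv ▸ contDiffAt_ringInverse ℝ v
    have h2 := h1.comp a hp.contDiffAt
    exact ((ContinuousLinearMap.apply ℂ H G).restrictScalars ℝ).contDiff.contDiffAt.comp a h2
      |>.contDiffWithinAt
  -- Off `I` the function `K` is arbitrary; on `I` it is the inverse applied to `G`.
  refine hs.congr fun a ha => ?_
  rw [← hK a ha, ← mul_apply_eq_comp, Ring.inverse_mul_cancel _ (hu a ha)]
  rfl

/-- The recursion satisfied by the derivatives of the solution of an affine family of equations. -/
theorem iteratedDeriv_of_affine_family (A B : H →L[ℂ] H) (G : H) {I : Set ℝ} (hI : IsOpen I)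
    {K : ℝ → H} (hs : ContDiffOn ℝ (⊤ : ℕ∞) K I)
    (hK : ∀ a ∈ I, (A + (a : ℂ) • B) (K a) = G) (n : ℕ) :
    ∀ a ∈ I, (A + (a : ℂ) • B) (iteratedDeriv (n + 1) K a)
      = -((n + 1 : ℕ) : ℂ) • B (iteratedDeriv n K a) := by
  have hd : ∀ n, ∀ a ∈ I, HasDerivAt (iteratedDeriv n K) (iteratedDeriv (n + 1) K a) a := by
    intro n a ha
    rw [iteratedDeriv_succ]
    refine DifferentiableAt.hasDerivAt ?_
    have h1 := (hs.contDiffAt (hI.mem_nhds ha)).iteratedFDeriv_right (i := n) (m := 1)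
      (by exact_mod_cast le_top)
    have h2 := h1.differentiableAt one_ne_zero
    rw [iteratedDeriv_eq_equiv_comp]
    exact ((ContinuousMultilinearMap.piFieldEquiv ℝ (Fin n) H).symm.differentiable _).comp a h2
  -- Product rule; the operator has constant derivative `B` in `a`.
  have hl : ∀ n, ∀ a ∈ I, HasDerivAt (fun a : ℝ => (A + (a : ℂ) • B) (iteratedDeriv n K a))
      (B (iteratedDeriv n K a) + (A + (a : ℂ) • B) (iteratedDeriv (n + 1) K a)) a := by
    intro n a ha
    have hA := (A.restrictScalars ℝ).hasFDerivAt.comp_hasDerivAt a (hd n a ha)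
    have hB := (B.restrictScalars ℝ).hasFDerivAt.comp_hasDerivAt a (hd n a ha)
    have := hA.add ((Complex.ofRealCLM.hasDerivAt (x := a)).smul hB)
    refine this.congr_deriv ?_
    simp
    abel
  induction n with
  | zero =>
    intro a ha
    have h1 := (hl 0 a ha).congr_of_eventuallyEq
      (f₁ := fun _ => G) (by
        filter_upwards [hI.mem_nhds ha] with b hb
        rw [iteratedDeriv_zero, hK b hb])
    have h2 := h1.unique (hasDerivAt_const a G)
    simpa using eq_neg_of_add_eq_zero_right h2
  | succ n ih =>
    intro a ha
    have hB := ((-((n + 1 : ℕ) : ℂ) • B).restrictScalars ℝ).hasFDerivAt.comp_hasDerivAt a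
      (hd n a ha)
    -- Both sides of the induction hypothesis are differentiated near `a`. The product rule
    -- contributes one further `B` term, raising the factor from `n + 1` to `n + 2`.
    have h1 := (hl (n + 1) a ha).congr_of_eventuallyEq
      (f₁ := fun a => -((n + 1 : ℕ) : ℂ) • B (iteratedDeriv n K a)) (by
        filter_upwards [hI.mem_nhds ha] with b hb
        rw [ih b hb])
    have h2 := h1.unique hB
    rw [eq_sub_of_add_eq' h2]
    simp
    module

end Hilbert

/-! ### Multiplication operators on $L^2$ -/

section Operators

variable {α : Type*} [MeasurableSpace α] {μ : Measure α} {m : ℕ}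

/-- Multiplication by an essentially bounded function on `L²`. -/
noncomputable def mulL2 {κ : α → ℂ} (hκ : MemLp κ ⊤ μ) :
    Lp (EuclideanSpace ℂ (Fin m)) 2 μ →L[ℂ] Lp (EuclideanSpace ℂ (Fin m)) 2 μ :=
  (ContinuousLinearMap.lsmul ℂ ℂ).holderL μ ⊤ 2 2 hκ.toLp

theorem coeFn_mulL2 {κ : α → ℂ} (hκ : MemLp κ ⊤ μ) (u : Lp (EuclideanSpace ℂ (Fin m)) 2 μ) :
    mulL2 hκ u =ᵐ[μ] fun x => κ x • u x := by
  have h := (ContinuousLinearMap.lsmul ℂ ℂ : ℂ →L[ℂ] EuclideanSpace ℂ (Fin m) →L[ℂ] _).coeFn_holder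
    (r := 2) hκ.toLp u
  filter_upwards [h, hκ.coeFn_toLp] with x h1 h2
  rw [← h2]
  exact h1

/-- Pointwise, $\operatorname{Re}(c\,\kappa|u|^2)=\operatorname{Re}(c\kappa)|u|^2\ge|u|^2$;
integrate. -/
theorem norm_sq_le_re_inner_mulL2 {κ : α → ℂ} (hκ : MemLp κ ⊤ μ) (c : ℂ)
    (h : ∀ᵐ x ∂μ, 1 ≤ (c * κ x).re) (u : Lp (EuclideanSpace ℂ (Fin m)) 2 μ) :
    ‖u‖ ^ 2 ≤ (c * inner ℂ u (mulL2 hκ u)).re := by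
  have h1 : (c * inner ℂ u (mulL2 hκ u)).re
      = ∫ x, (c * inner ℂ (u x) (mulL2 hκ u x)).re ∂μ := by
    rw [L2.inner_def, ← integral_const_mul]
    exact (integral_re ((L2.integrable_inner (𝕜 := ℂ) u (mulL2 hκ u)).const_mul c)).symm
  have h2 : ‖u‖ ^ 2 = ∫ x, ‖u x‖ ^ 2 ∂μ := by
    have h3 : inner ℂ u u = ((‖u‖ ^ 2 : ℝ) : ℂ) := by
      rw [inner_self_eq_norm_sq_to_K]; norm_cast
    have h4 : inner ℂ u u = ((∫ x, ‖u x‖ ^ 2 ∂μ : ℝ) : ℂ) := by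
      rw [L2.inner_def, ← integral_complex_ofReal]
      refine integral_congr_ae (Filter.Eventually.of_forall fun x => ?_)
      simp only [inner_self_eq_norm_sq_to_K]; norm_cast
    exact_mod_cast h3.symm.trans h4
  rw [h1, h2]
  refine integral_mono_ae ((memLp_two_iff_integrable_sq_norm (Lp.aestronglyMeasurable u)).1
    (Lp.memLp u)) ((L2.integrable_inner (𝕜 := ℂ) u (mulL2 hκ u)).const_mul c).re ?_
  filter_upwards [h, coeFn_mulL2 hκ u] with x hx hm
  have h5 : (c * inner ℂ (u x) (mulL2 hκ u x)).re = (c * κ x).re * ‖u x‖ ^ 2 := by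
    rw [hm, inner_smul_right, inner_self_eq_norm_sq_to_K, ← mul_assoc]
    have : ((‖u x‖ : ℂ)) ^ 2 = ((‖u x‖ ^ 2 : ℝ) : ℂ) := by norm_cast
    exact (congrArg (fun z => (c * κ x * z).re) this).trans (Complex.re_mul_ofReal _ _)
  show ‖u x‖ ^ 2 ≤ (c * inner ℂ (u x) (mulL2 hκ u x)).re
  rw [h5]
  nlinarith [sq_nonneg ‖u x‖]

end Operators

end Maxwell

namespace Maxwell

noncomputable section

variable {d : Dim} {Ω : Set (Space d)}

/-- The inner product of `H(curl)`; this instance keeps the search for one short. -/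
instance instInnerHCurl : Inner ℂ (HCurl d Ω) := InnerProductSpace.toInner

/-! ### Completeness of $H(\operatorname{curl})$ -/

theorem cross_add_left (d : Dim) (ξ η : Space d) (u : Vec d) :
    cross d (ξ + η) u = cross d ξ u + cross d η u := by
  cases d <;> ext l <;> fin_cases l <;> simp [cross] <;> ring

theorem cross_smul_left (d : Dim) (c : ℝ) (ξ : Space d) (u : Vec d) :
    cross d (c • ξ) u = c • cross d ξ u := by
  cases d <;> ext l <;> fin_cases l <;> simp [cross] <;> ring

theorem cross_smul_right (d : Dim) (c : ℝ) (ξ : Space d) (u : Vec d) :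
    cross d ξ (c • u) = c • cross d ξ u := by
  simpa using cross_smul d ξ (c : ℂ) u

/-- The cross product as a continuous real bilinear map. -/
def crossL (d : Dim) : Space d →L[ℝ] Vec d →L[ℝ] CVec d :=
  LinearMap.mkContinuous₂ (LinearMap.mk₂ ℝ (cross d) (cross_add_left d) (cross_smul_left d)
    (cross_add d) (cross_smul_right d)) 6 fun ξ u => by
      simpa [mul_assoc] using norm_cross_le d ξ u

theorem IsTest.memLp {ψ : Space d → ℝ} (hψ : IsTest ψ) : MemLp ψ 2 (volume.restrict Ω) :=
  (hψ.contDiff.continuous.memLp_of_hasCompactSupport hψ.hasCompactSupport).restrict Ω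

theorem IsTest.memLp_gradient {ψ : Space d → ℝ} (hψ : IsTest ψ) :
    MemLp (gradient ψ) 2 (volume.restrict Ω) := by
  have hc : Continuous (gradient ψ) :=
    (InnerProductSpace.toDual ℝ (Space d)).symm.continuous.comp
      (hψ.contDiff.continuous_fderiv (by simp))
  have hs : HasCompactSupport (gradient ψ) :=
    (hψ.hasCompactSupport.fderiv ℝ).comp_left
      (g := (InnerProductSpace.toDual ℝ (Space d)).symm) (map_zero _)
  exact (hc.memLp_of_hasCompactSupport hs).restrict Ω

/-- Both integrals are bounded pairings of $L^2$ fields with the fixed $L^2$ functions $\psi$ and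
$\nabla\psi$. -/
theorem continuous_greenDefect {ψ : Space d → ℝ} (hψ : IsTest ψ) :
    Continuous fun z : L2Vec d Ω × L2CVec d Ω => greenDefect d Ω ψ z.1 z.2 := by
  have h1 : ∀ w : L2CVec d Ω, ∫ x in Ω, ψ x • w x
      = (ContinuousLinearMap.lsmul ℝ ℝ).lpPairing (volume.restrict Ω) 2 2 hψ.memLp.toLp w :=
    fun w => by
      rw [ContinuousLinearMap.lpPairing_eq_integral]
      refine integral_congr_ae ?_
      filter_upwards [(hψ.memLp (Ω := Ω)).coeFn_toLp] with x hx
      rw [hx]; rfl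
  have h2 : ∀ u : L2Vec d Ω, ∫ x in Ω, cross d (gradient ψ x) (u x)
      = (crossL d).lpPairing (volume.restrict Ω) 2 2 hψ.memLp_gradient.toLp u :=
    fun u => by
      rw [ContinuousLinearMap.lpPairing_eq_integral]
      refine integral_congr_ae ?_
      filter_upwards [(hψ.memLp_gradient (Ω := Ω)).coeFn_toLp] with x hx
      rw [hx]; rfl
  simp only [greenDefect, h1, h2]
  fun_prop

/-- The weak curl relation is an intersection of zero sets of continuous maps, one for each test
function, hence closed in a complete space. -/
instance : CompleteSpace (HCurl d Ω) := by
  suffices hc : IsClosed (HCurlSubmodule d Ω : Set (WithLp 2 (L2Vec d Ω × L2CVec d Ω))) from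
    hc.completeSpace_coe
  have h : (HCurlSubmodule d Ω : Set (WithLp 2 (L2Vec d Ω × L2CVec d Ω)))
      = ⋂ ψ : {ψ : Space d → ℝ // IsTest ψ ∧ tsupport ψ ⊆ Ω},
        {z | greenDefect d Ω ψ.1 z.fst z.snd = 0} := by
    ext z
    rw [Set.mem_iInter]
    exact isWeakCurl_iff.trans ⟨fun h ψ => h ψ.1 ψ.2.1 ψ.2.2, fun h ψ h1 h2 => h ⟨ψ, h1, h2⟩⟩
  rw [h]
  refine isClosed_iInter fun ψ => isClosed_eq ?_ continuous_const
  exact (continuous_greenDefect ψ.2.1).comp (WithLp.prod_continuous_ofLp 2 _ _)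

/-! ### Operators representing the sesquilinear forms -/

/-- The underlying field as a bounded operator on `H(curl)`. -/
def fieldL : HCurl d Ω →L[ℂ] L2Vec d Ω :=
  (WithLp.fstL 2 ℂ (L2Vec d Ω) (L2CVec d Ω)).comp (HCurlSubmodule d Ω).subtypeL

/-- The curl as a bounded operator on `H(curl)`. -/
def curlL : HCurl d Ω →L[ℂ] L2CVec d Ω :=
  (WithLp.sndL 2 ℂ (L2Vec d Ω) (L2CVec d Ω)).comp (HCurlSubmodule d Ω).subtypeL

theorem norm_sq_eq (E : HCurl d Ω) : ‖E‖ ^ 2 = ‖field E‖ ^ 2 + ‖curl E‖ ^ 2 :=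
  WithLp.prod_norm_sq_eq_of_L2 E.1

/-- The operator of the form `(κ E, φ)` on `H(curl)`. -/
def massOp {κ : Space d → ℂ} (hκ : MemLp κ ⊤ (volume.restrict Ω)) : HCurl d Ω →L[ℂ] HCurl d Ω :=
  (ContinuousLinearMap.adjoint fieldL).comp ((mulL2 hκ).comp fieldL)

theorem inner_massOp {κ : Space d → ℂ} (hκ : MemLp κ ⊤ (volume.restrict Ω)) (E φ : HCurl d Ω) :
    inner ℂ φ (massOp hκ E) = inner ℂ (field φ) (mulL2 hκ (field E)) := by
  have h := ContinuousLinearMap.adjoint_inner_right fieldL φ (mulL2 hκ (fieldL E))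
  exact h

theorem dotL2_mul_eq {κ : Space d → ℂ} (hκ : MemLp κ ⊤ (volume.restrict Ω)) (E φ : HCurl d Ω) :
    dotL2 Ω (fun x => κ x • field E x) (field φ) = inner ℂ φ (massOp hκ E) := by
  rw [inner_massOp, L2.inner_def]
  refine integral_congr_ae ?_
  filter_upwards [coeFn_mulL2 hκ (field E)] with x hx
  rw [hx]

/-- The operator of the form `(curl E, curl φ) - k² (κ E, φ)` on `H(curl)`. -/
def maxwellOp (k : ℝ) {κ : Space d → ℂ} (hκ : MemLp κ ⊤ (volume.restrict Ω)) :
    HCurl d Ω →L[ℂ] HCurl d Ω :=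
  (ContinuousLinearMap.adjoint curlL).comp curlL - (k : ℂ) ^ 2 • massOp hκ

theorem inner_maxwellOp (k : ℝ) {κ : Space d → ℂ} (hκ : MemLp κ ⊤ (volume.restrict Ω))
    (E φ : HCurl d Ω) : inner ℂ φ (maxwellOp k hκ E)
      = inner ℂ (curl φ) (curl E) - (k : ℂ) ^ 2 * inner ℂ φ (massOp hκ E) := by
  have h : inner ℂ φ (ContinuousLinearMap.adjoint curlL (curlL E)) = inner ℂ (curl φ) (curl E) :=
    ContinuousLinearMap.adjoint_inner_right _ _ _
  rw [← h, ← inner_smul_right, ← inner_sub_right]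
  rfl

theorem maxwellForm_eq (k : ℝ) {κ : Space d → ℂ} (hκ : MemLp κ ⊤ (volume.restrict Ω))
    (E φ : HCurl d Ω) : maxwellForm k κ E φ = inner ℂ φ (maxwellOp k hκ E) := by
  rw [inner_maxwellOp, ← dotL2_mul_eq, L2.inner_def]
  rfl

/-! ### Invertibility for admissible indices -/

theorem IsAdmissible.memLp {ε₀ ω : ℝ} {κ : Space d → ℂ} (h : IsAdmissible Ω ε₀ ω κ) :
    MemLp κ ⊤ (volume.restrict Ω) := by
  obtain ⟨ε, σ, hp, he⟩ := h
  refine MemLp.ae_eq (Filter.EventuallyEq.symm he) ?_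
  have h1 : MemLp (fun x => (ε x : ℂ)) ⊤ (volume.restrict Ω) := hp.bounded_permittivity.ofReal
  have h2 : MemLp (fun x => (σ x : ℂ)) ⊤ (volume.restrict Ω) := hp.bounded_conductivity.ofReal
  have := (h1.add (h2.const_mul (Complex.I / ω))).const_mul (1 / (ε₀ : ℂ))
  refine this.ae_eq (Filter.Eventually.of_forall fun x => ?_)
  simp only [refractiveIndex, Pi.add_apply]
  ring

/-- After a rotation, `-k² κ` has real part at least `1`. -/
theorem IsAdmissible.exists_rotation {ε₀ ω k : ℝ} (hε₀ : 0 < ε₀) (hω : 0 < ω) (hk : k ≠ 0)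
    {κ : Space d → ℂ} (h : IsAdmissible Ω ε₀ ω κ) :
    ∃ t : ℝ, ∀ᵐ x ∂(volume.restrict Ω), 1 ≤ (-(1 + t * Complex.I) * (k : ℂ) ^ 2 * κ x).re := by
  obtain ⟨ε, σ, hp, he⟩ := h
  obtain ⟨c, hc, hσ⟩ := hp.conductivity_pos
  obtain ⟨M, hM⟩ : ∃ M : ℝ, ∀ᵐ x ∂(volume.restrict Ω), |ε x| ≤ M := by
    have := hp.bounded_permittivity.2
    rw [eLpNorm_exponent_top] at this
    refine ⟨(eLpNormEssSup ε (volume.restrict Ω)).toReal, ?_⟩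
    filter_upwards [ae_le_eLpNormEssSup (f := ε) (μ := volume.restrict Ω)] with x hx
    rw [← Real.norm_eq_abs, ← toReal_enorm]
    exact ENNReal.toReal_mono this.ne hx
  -- The real part is $\frac{k^2}{\varepsilon_0}(t\sigma/\omega-\varepsilon)$. Since $\sigma\ge c$,
  -- this $t$ gives $t\sigma/\omega\ge\varepsilon_0/k^2+|M|$: the term $|M|$ absorbs $\varepsilon$
  -- and the rest yields exactly $1$.
  refine ⟨(ε₀ / k ^ 2 + |M|) * ω / c, ?_⟩
  filter_upwards [he, hσ, hM] with x hx h1 h2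
  have hre : (-(1 + ((((ε₀ / k ^ 2 + |M|) * ω / c : ℝ)) : ℂ) * Complex.I) * (k : ℂ) ^ 2 * κ x).re
      = k ^ 2 / ε₀ * ((ε₀ / k ^ 2 + |M|) * (σ x / c) - ε x) := by
    have : κ x = ((ε x / ε₀ : ℝ) : ℂ) + ((σ x / (ε₀ * ω) : ℝ) : ℂ) * Complex.I := by
      rw [hx, refractiveIndex]
      have : (ε₀ : ℂ) ≠ 0 := by exact_mod_cast hε₀.ne'
      have : (ω : ℂ) ≠ 0 := by exact_mod_cast hω.ne'
      push_cast
      field_simp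
    rw [this, ← Complex.ofReal_pow, show
      (-(1 + ((((ε₀ / k ^ 2 + |M|) * ω / c : ℝ)) : ℂ) * Complex.I) * ((k ^ 2 : ℝ) : ℂ)
        * (((ε x / ε₀ : ℝ) : ℂ) + ((σ x / (ε₀ * ω) : ℝ) : ℂ) * Complex.I))
      = ((k ^ 2 : ℝ) : ℂ) * (-((1 + ((((ε₀ / k ^ 2 + |M|) * ω / c : ℝ)) : ℂ) * Complex.I)
        * (((ε x / ε₀ : ℝ) : ℂ) + ((σ x / (ε₀ * ω) : ℝ) : ℂ) * Complex.I))) by ring,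
      Complex.re_ofReal_mul]
    generalize ε₀ / k ^ 2 + |M| = s
    simp only [Complex.neg_re, Complex.mul_re, Complex.add_re, Complex.add_im, Complex.one_re,
      Complex.one_im, Complex.ofReal_re, Complex.ofReal_im, Complex.I_re, Complex.I_im,
      Complex.mul_im]
    field_simp
    ring
  rw [hre]
  have h3 : 1 ≤ σ x / c := (one_le_div hc).2 h1
  have hk2 : 0 < k ^ 2 := by positivity
  have h4 : ε₀ / k ^ 2 ≤ (ε₀ / k ^ 2 + |M|) * (σ x / c) - ε x := by
    have h5 : 0 ≤ ε₀ / k ^ 2 + |M| := by positivity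
    have h6 := le_mul_of_one_le_right h5 h3
    have h7 := (le_abs_self _).trans (h2.trans (le_abs_self M))
    linarith
  calc (1 : ℝ) = k ^ 2 / ε₀ * (ε₀ / k ^ 2) := by field_simp
    _ ≤ _ := by gcongr

/-- The rotation by $1+it$ makes the mass term dominate $\|E\|_{L^2}^2$, and the curl term has real
part $\|\operatorname{curl}E\|_{L^2}^2$; together they bound the full graph norm. -/
theorem isUnit_maxwellOp {ε₀ ω k : ℝ} (hε₀ : 0 < ε₀) (hω : 0 < ω) (hk : k ≠ 0)
    {κ : Space d → ℂ} (h : IsAdmissible Ω ε₀ ω κ) : IsUnit (maxwellOp k h.memLp) := by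
  obtain ⟨t, ht⟩ := h.exists_rotation hε₀ hω hk
  refine isUnit_of_rotated_coercive _ (1 + t * Complex.I) fun E => ?_
  have h1 := norm_sq_le_re_inner_mulL2 h.memLp _ ht (field E)
  have h2 : ((1 + t * Complex.I) * inner ℂ (curl E) (curl E)).re = ‖curl E‖ ^ 2 := by
    have : inner ℂ (curl E) (curl E) = ((‖curl E‖ ^ 2 : ℝ) : ℂ) := by
      rw [inner_self_eq_norm_sq_to_K]; norm_cast
    rw [this, Complex.re_mul_ofReal]
    simp
  rw [inner_maxwellOp, inner_massOp, mul_sub, Complex.sub_re, h2, norm_sq_eq]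
  have h3 : -(1 + t * Complex.I) * (k : ℂ) ^ 2 * inner ℂ (field E) (mulL2 h.memLp (field E))
      = -((1 + t * Complex.I) * ((k : ℂ) ^ 2 * inner ℂ (field E) (mulL2 h.memLp (field E)))) := by
    ring
  rw [h3, Complex.neg_re] at h1
  linarith

/-! ### Affine dependence on the amplitude -/

theorem memLp_indicator_mul {κ : Space d → ℂ} (hκ : MemLp κ ⊤ (volume.restrict Ω))
    {D : Set (Space d)} (hD : MeasurableSet D) :
    MemLp (fun x => κ x * chi D x) ⊤ (volume.restrict Ω) := by
  refine (hκ.indicator hD).ae_eq (Filter.Eventually.of_forall fun x => ?_)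
  by_cases hx : x ∈ D <;> simp [chi, hx]

/-- If the perturbed indices are bounded on an open set of amplitudes, then so is the background
index: the amplitude `-1` can be avoided. -/
theorem memLp_of_perturbedIndex {κ₀ : Space d → ℂ} {D : Set (Space d)} (hD : MeasurableSet D)
    {I : Set ℝ} (hI : IsOpen I) (hne : I.Nonempty)
    (h : ∀ a ∈ I, MemLp (perturbedIndex κ₀ D a) ⊤ (volume.restrict Ω)) :
    MemLp κ₀ ⊤ (volume.restrict Ω) := by
  obtain ⟨a, ha, ha1⟩ : ∃ a ∈ I, a ≠ -1 := by
    by_contra! hcon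
    obtain ⟨b, hb⟩ := hne
    have : I = {-1} := Set.Subset.antisymm hcon (by rintro _ rfl; exact hcon b hb ▸ hb)
    exact not_isOpen_singleton (-1 : ℝ) (this ▸ hI)
  have ha2 : (1 + a : ℂ) ≠ 0 := by
    intro h0
    exact ha1 (by linarith [show (1 + a : ℝ) = 0 by exact_mod_cast h0])
  -- On $D$ one has $\kappa_a=(1+a)\kappa_0$ and elsewhere $\kappa_a=\kappa_0$, so
  -- $\kappa_0=\kappa_a-\frac{a}{1+a}\kappa_a\chi_D$.
  have h1 := (h a ha).sub ((memLp_indicator_mul (h a ha) hD).const_mul (a / (1 + a) : ℂ))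
  refine h1.ae_eq (Filter.Eventually.of_forall fun x => ?_)
  by_cases hx : x ∈ D
  · simp [chi, perturbedIndex, hx]
    field_simp
    ring
  · simp [chi, perturbedIndex, hx]

theorem maxwellOp_perturbedIndex (k : ℝ) {κ₀ : Space d → ℂ} {D : Set (Space d)} (a : ℝ)
    (h₀ : MemLp κ₀ ⊤ (volume.restrict Ω))
    (h₁ : MemLp (fun x => κ₀ x * chi D x) ⊤ (volume.restrict Ω))
    (h : MemLp (perturbedIndex κ₀ D a) ⊤ (volume.restrict Ω)) :
    maxwellOp k h = maxwellOp k h₀ + (a : ℂ) • (-(k : ℂ) ^ 2 • massOp h₁) := by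
  have h2 : h.toLp = h₀.toLp + (a : ℂ) • h₁.toLp := by
    rw [← MemLp.toLp_const_smul, ← MemLp.toLp_add]
    refine MemLp.toLp_congr _ _ (Filter.Eventually.of_forall fun x => ?_)
    simp only [perturbedIndex, Pi.add_apply, Pi.smul_apply, smul_eq_mul]
    ring
  have h3 : massOp h = massOp h₀ + (a : ℂ) • massOp h₁ := by
    simp only [massOp, mulL2, h2, map_add, map_smul, ContinuousLinearMap.add_comp,
      ContinuousLinearMap.smul_comp, ContinuousLinearMap.comp_add, ContinuousLinearMap.comp_smul]
  rw [maxwellOp, maxwellOp, h3]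
  module

/-! ### Weak formulations as operator equations -/

/-- The Riesz representative of a Neumann datum. -/
theorem exists_riesz (g : NeumannData d Ω) :
    ∃ G : HCurl d Ω, ∀ φ, inner ℂ φ G = g (tangentialComponent φ) := by
  let f : HCurl d Ω →L[ℂ] ℂ :=
    -- The bracket is antilinear in `φ`; conjugation makes it a linear functional, as the Riesz
    -- theorem requires.
    { toFun := fun φ => starRingEnd ℂ (g (tangentialComponent φ))
      map_add' := fun φ ψ => by
        rw [show tangentialComponent (φ + ψ) = tangentialComponent φ + tangentialComponent ψ
          from rfl, map_add, map_add]
      map_smul' := fun c φ => by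
        rw [show tangentialComponent (c • φ) = c • tangentialComponent φ from rfl]
        simp
      cont := Complex.continuous_conj.comp (g.continuous.comp continuous_quot_mk) }
  refine ⟨(InnerProductSpace.toDual ℂ _).symm f, fun φ => ?_⟩
  rw [← inner_conj_symm, InnerProductSpace.toDual_symm_apply]
  exact Complex.conj_conj _

theorem isDirectSolution_iff {k : ℝ} {κ : Space d → ℂ} (hκ : MemLp κ ⊤ (volume.restrict Ω))
    {g : NeumannData d Ω} {G : HCurl d Ω} (hG : ∀ φ, inner ℂ φ G = g (tangentialComponent φ))
    (E : HCurl d Ω) : IsDirectSolution k g κ E ↔ maxwellOp k hκ E = G := by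
  simp only [IsDirectSolution, maxwellForm_eq k hκ, ← hG]
  exact ⟨ext_inner_left ℂ, fun h φ => by rw [h]⟩

/-- The right-hand side is kept as $-n\,(-k^2\,\cdot)$ so that it coincides with $-nB$ in the
recursion for the derivatives. -/
theorem isSensitivitySolution_iff {k : ℝ} {κ₀ : Space d → ℂ} {D : Set (Space d)} {a : ℝ}
    (h₁ : MemLp (fun x => κ₀ x * chi D x) ⊤ (volume.restrict Ω))
    (h : MemLp (perturbedIndex κ₀ D a) ⊤ (volume.restrict Ω)) (n : ℕ) (F E : HCurl d Ω) :
    IsSensitivitySolution k κ₀ D a n F E ↔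
      maxwellOp k h E = -(n : ℂ) • (-(k : ℂ) ^ 2 • massOp h₁) F := by
  have h2 : ∀ φ, (n : ℂ) * (k : ℂ) ^ 2 * dotL2 Ω (fun x => (κ₀ x * chi D x) • field F x) (field φ)
      = inner ℂ φ (-(n : ℂ) • (-(k : ℂ) ^ 2 • massOp h₁) F) := fun φ => by
    have h3 : inner ℂ φ (-(n : ℂ) • (-(k : ℂ) ^ 2 • massOp h₁) F)
        = -(n : ℂ) * (-(k : ℂ) ^ 2 * inner ℂ φ (massOp h₁ F)) :=
      (inner_smul_right φ ((-(k : ℂ) ^ 2) • massOp h₁ F) _).trans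
        (congrArg _ (inner_smul_right φ (massOp h₁ F) _))
    rw [dotL2_mul_eq h₁, h3]
    ring
  simp only [IsSensitivitySolution, maxwellForm_eq k h, h2]
  exact ⟨ext_inner_left ℂ, fun h φ => by rw [h]⟩

end

end Maxwell

/-! ### The main theorem -/

theorem theorem2 (d : Maxwell.Dim) (Ω : Set (Maxwell.Space d)) (hΩ : IsOpen Ω)
    (ε₀ μ₀ ω : ℝ) (hε₀ : 0 < ε₀) (hμ₀ : 0 < μ₀) (hω : 0 < ω)
    (k : ℝ) (hk : k = Maxwell.waveNumber ε₀ μ₀ ω)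
    (gN : Maxwell.NeumannData d Ω)
    (κ₀ : Maxwell.Space d → ℂ) (D : Set (Maxwell.Space d)) (hD : MeasurableSet D)
    (I : Set ℝ) (hI : IsOpen I) (hI' : I.OrdConnected)
    (hadm : ∀ a ∈ I, Maxwell.IsAdmissible Ω ε₀ ω (Maxwell.perturbedIndex κ₀ D a))
    (K : ℝ → Maxwell.HCurl d Ω) (hK : K = Maxwell.amplitudeToField k gN κ₀ D) :
    ContDiffOn ℝ (⊤ : ℕ∞) K I ∧
    (∀ a ∈ I,
      Maxwell.IsDirectSolution k gN (Maxwell.perturbedIndex κ₀ D a) (iteratedDeriv 0 K a) ∧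
      ∀ E : Maxwell.HCurl d Ω,
        Maxwell.IsDirectSolution k gN (Maxwell.perturbedIndex κ₀ D a) E →
          E = iteratedDeriv 0 K a) ∧
    (∀ a ∈ I, ∀ n : ℕ, 1 ≤ n →
      Maxwell.IsSensitivitySolution k κ₀ D a n (iteratedDeriv (n - 1) K a) (iteratedDeriv n K a) ∧
      ∀ E : Maxwell.HCurl d Ω,
        Maxwell.IsSensitivitySolution k κ₀ D a n (iteratedDeriv (n - 1) K a) E →
          E = iteratedDeriv n K a) := by
  have hk0 : k ≠ 0 := by
    rw [hk, Maxwell.waveNumber]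
    positivity
  -- Boundedness of $\kappa_0$ is deduced from some $\kappa_a$ with $a\in I$, so the empty interval
  -- is treated apart.
  rcases I.eq_empty_or_nonempty with rfl | hne
  · exact ⟨contDiffOn_empty, fun _ h => h.elim, fun _ h => h.elim⟩
  have hm : ∀ a ∈ I, MemLp (Maxwell.perturbedIndex κ₀ D a) ⊤ (volume.restrict Ω) :=
    fun a ha => (hadm a ha).memLp
  have h₀ := Maxwell.memLp_of_perturbedIndex hD hI hne hm
  have h₁ := Maxwell.memLp_indicator_mul h₀ hD
  obtain ⟨G, hG⟩ := Maxwell.exists_riesz gN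
  set A := Maxwell.maxwellOp k h₀
  set B := -(k : ℂ) ^ 2 • Maxwell.massOp h₁ with hB
  have hop : ∀ a (ha : a ∈ I), Maxwell.maxwellOp k (hm a ha) = A + (a : ℂ) • B :=
    fun a ha => Maxwell.maxwellOp_perturbedIndex k a h₀ h₁ (hm a ha)
  have hu : ∀ a ∈ I, IsUnit (A + (a : ℂ) • B) := fun a ha =>
    hop a ha ▸ Maxwell.isUnit_maxwellOp hε₀ hω hk0 (hadm a ha)
  have hinj : ∀ a ∈ I, Function.Injective (A + (a : ℂ) • B) := fun a ha =>
    (ContinuousLinearMap.isUnit_iff_bijective.1 (hu a ha)).1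
  have hdir : ∀ a ∈ I, ∀ E : Maxwell.HCurl d Ω,
      Maxwell.IsDirectSolution k gN (Maxwell.perturbedIndex κ₀ D a) E
        ↔ (A + (a : ℂ) • B) E = G := fun a ha E =>
    hop a ha ▸ Maxwell.isDirectSolution_iff (hm a ha) hG E
  have hKd : ∀ a ∈ I, Maxwell.IsDirectSolution k gN (Maxwell.perturbedIndex κ₀ D a) (K a) := by
    intro a ha
    -- Surjectivity provides a solution, so the choice defining `K a` really selects one.
    obtain ⟨E, hE⟩ := (ContinuousLinearMap.isUnit_iff_bijective.1 (hu a ha)).2 G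
    rw [hK]
    exact Classical.epsilon_spec (p := fun E =>
      Maxwell.IsDirectSolution k gN (Maxwell.perturbedIndex κ₀ D a) E) ⟨E, (hdir a ha E).2 hE⟩
  have hKe : ∀ a ∈ I, (A + (a : ℂ) • B) (K a) = G := fun a ha => (hdir a ha _).1 (hKd a ha)
  have hs := Maxwell.contDiffOn_of_affine_family A B G hu hKe
  refine ⟨hs, fun a ha => ?_, fun a ha n hn => ?_⟩
  · rw [iteratedDeriv_zero]
    exact ⟨hKd a ha, fun E hE =>
      hinj a ha (((hdir a ha E).1 hE).trans (hKe a ha).symm)⟩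
  · obtain ⟨n, rfl⟩ := Nat.exists_eq_add_of_le' hn
    have hrec := Maxwell.iteratedDeriv_of_affine_family A B G hI hs hKe n a ha
    have hsens := Maxwell.isSensitivitySolution_iff (k := k) h₁ (hm a ha) (n + 1)
      (iteratedDeriv n K a)
    rw [hop a ha] at hsens
    exact ⟨(hsens _).2 hrec, fun E hE => hinj a ha (((hsens E).1 hE).trans hrec.symm)⟩
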